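/- For $\lambda,\gamma,x,u\in\mathbb{C}$ let $(a)_n=a(a+1)\cdots(a+n-1)$, let ${}_2F_1$ be the Gauss hypergeometric series, and let the Gegenbauer polynomials $C_n^\lambda(x)$ be defined by $\sum_{n\ge0}C_n^\lambda(x)t^n=(1-2xt+t^2)^{-\lambda}$. Define formal power series in $t$ by $R=(1-2xt+t^2)^{1/2}$ and $U=[1-2(1-u)xt+(1-u)^2t^2]^{1/2}$, both with constant term $1$. A complex power of a power series with constant term $1$ is the binomial series, so it again has constant term $1$. Theorem. Let $\lambda\in\mathbb{C}\setminus\{0,-1/2,-1,-3/2,\dots\}$ and $\gamma,x\in\mathbb{C}$. For every $u\in\mathbb{C}$, as equalities between power series in $t$, $$\sum_{n=0}^\infty {}_2F_1\!\left({-n,\;2\lambda-\gamma\atop 2\lambda}\,\Big|\,u\right)C_n^\lambda(x)t^n =U^{\gamma-2\lambda}R^{-\gamma}\,{}_2F_1\!\left({\gamma,\;2\lambda-\gamma\atop \lambda+1/2}\,\Big|\,\frac{UR-[R^2+u(x-t)t]}{2UR}\right)$$ $$=U^{2\gamma-2\lambda}\,[R^2+u(x-t)t]^{-\gamma}\,{}_2F_1\!\left({\gamma/2,\;\gamma/2+1/2\atop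 \lambda+1/2}\,\Big|\,1-\left[\frac{UR}{R^2+u(x-t)t}\right]^2\right).$$ Moreover, at $u=1$ one has ${}_2F_1(-n,2\lambda-\gamma;2\lambda;1)=(\gamma)_n/(2\lambda)_n$ for all $n\ge0$, $U=1$ and $R^2+u(x-t)t=1-xt$, so that the identities reduce to Brafman's: $$\sum_{n=0}^\infty\frac{(\gamma)_n}{(2\lambda)_n}C_n^\lambda(x)t^n =R^{-\gamma}\,{}_2F_1\!\left({\gamma,\;2\lambda-\gamma\atop\lambda+1/2}\,\Big|\,\frac{R-1+xt}{2R}\right) =(1-xt)^{-\gamma}\,{}_2F_1\!\left({\gamma/2,\;\gamma/2+1/2\atop\lambda+1/2}\,\Big|\,1-\left(\frac{R}{1-xt}\right)^2\right).$$ -/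

import Mathlib

open PowerSeries

noncomputable section

namespace Gegenbauer

/-- The complex power `f ^ a = ∑ₖ (a choose k) (f - 1) ^ k` of a formal power series `f` with
constant coefficient `1`. It is the branch with constant coefficient `1`. -/
def cpow {A : Type*} [CommRing A] [Algebra ℂ A] (f : A⟦X⟧) (a : ℂ) : A⟦X⟧ :=
  (binomialSeries A a).subst (f - 1)

/-- The Gegenbauer polynomial `C_n^l`: the coefficient of `t ^ n` in `(1 - 2 x t + t ^ 2) ^ (-l)`,
where the coefficients are polynomials in the indeterminate `x`. -/
def gegenbauer (l : ℂ) (n : ℕ) : Polynomial ℂ :=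
  coeff n (cpow (1 - 2 * C (Polynomial.X : Polynomial ℂ) * X + X ^ 2) (-l))

/-- The Gauss hypergeometric series `₂F₁(a, b; c; z)` as a formal power series in `z`. -/
def hypSeries (a b c : ℂ) : ℂ⟦X⟧ :=
  PowerSeries.mk fun n => ordinaryHypergeometricCoefficient a b c n

/-- `₂F₁(a, b; c; f)` for a formal power series `f` with zero constant coefficient. -/
def hypSubst (a b c : ℂ) (f : ℂ⟦X⟧) : ℂ⟦X⟧ :=
  (hypSeries a b c).subst f

/-- `R = (1 - 2 x t + t ^ 2) ^ (1 / 2)`, with `R = 1` at `t = 0`. -/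
def seriesR (x : ℂ) : ℂ⟦X⟧ :=
  cpow (1 - 2 * C x * X + X ^ 2) (1 / 2)

/-- `U = (1 - 2 (1 - u) x t + (1 - u) ^ 2 t ^ 2) ^ (1 / 2)`, with `U = 1` at `t = 0`. -/
def seriesU (x u : ℂ) : ℂ⟦X⟧ :=
  cpow (1 - 2 * C ((1 - u) * x) * X + C ((1 - u) ^ 2) * X ^ 2) (1 / 2)

/-- `V = R ^ 2 + u (x - t) t`. -/
def seriesV (x u : ℂ) : ℂ⟦X⟧ :=
  seriesR x ^ 2 + C u * (C x - X) * X

end Gegenbauer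

end

noncomputable section

namespace Gegenbauer

open scoped PowerSeries.WithPiTopology

/-! ### Substitution of a power series without constant term -/

/-! Put `Q = 1 - 2xt + t²`, `G = Q^(-λ)`, `w = 2λ - γ`. Expanding the terminating `₂F₁` in powers of
`u` and summing over `n` first turns the left side into `∑ₖ (w)ₖ (-ut)ᵏ G⁽ᵏ⁾ / (k! (2λ)ₖ)`
(`hasSum_iterate_derivative`). The Taylor shift `G(t+s) = G (1 - 2ps + s²/Q)^(-λ)`, `p = (x-t)/Q`,
suggests that `G⁽ᵏ⁾ / (k! (2λ)ₖ G)` is the coefficient of `sᵏ` in `exp(ps) ₀F₁(; λ+1/2; ds²/4)` with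
`d = p² - 1/Q`. This is proved by matching three-term recurrences (`iterate_derivative_cpow`).
Weighting these coefficients by `(w)ₖ` sums them to a binomial power times a `₂F₁(w/2, w/2+1/2;
λ+1/2; ·)` (`hasSum_expBesselCoeff`), with argument `1 - (UR/V)²`, because `V² - U²R² = (x²-1)u²t²`.
The quadratic transformation (`hypSubst_eq_quadratic`) rewrites it as `₂F₁(w, γ; λ+1/2;
(UR-V)/(2UR))`, the first form. This is symmetric in `w` and `γ`, so reversing the transformation
from `γ` gives the second form. At `u = 1` Chu–Vandermonde evaluates the coefficients. -/

lemma hasSubst_sub_one {A : Type*} [CommRing A] {f : A⟦X⟧} (hf : constantCoeff f = 1) :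
    HasSubst (f - 1) :=
  HasSubst.of_constantCoeff_zero' (by simp [hf])

/-- Each coefficient receives finitely many nonzero terms, so formal substitution becomes a sum in
the product topology, where double series can be rearranged. -/
lemma hasSum_subst (F : ℂ⟦X⟧) {f : ℂ⟦X⟧} (hf : constantCoeff f = 0) :
    HasSum (fun k => C (coeff k F) * f ^ k) (F.subst f) := by
  have hs : HasSubst f := HasSubst.of_constantCoeff_zero' hf
  rw [PowerSeries.WithPiTopology.hasSum_iff_hasSum_coeff]
  intro d
  have h := coeff_subst_finite' hs F d
  rw [coeff_subst' hs]
  simp only [coeff_C_mul]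
  rw [finsum_eq_sum_of_support_subset (s := h.toFinset) _ (by simp)]
  refine hasSum_sum_of_ne_finset_zero fun k hk => ?_
  simpa [or_iff_not_imp_left] using hk

lemma derivative_C_mul (a : ℂ) (f : ℂ⟦X⟧) : d⁄dX ℂ (C a * f) = C a * d⁄dX ℂ f := by
  simp [Derivation.leibniz]

/-! ### Complex powers -/

lemma constantCoeff_cpow {f : ℂ⟦X⟧} (hf : constantCoeff f = 1) (a : ℂ) :
    constantCoeff (cpow f a) = 1 := by
  have h : constantCoeff (PowerSeries.binomialSeries ℂ a - 1) = 0 := by simp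
  have hf0 : constantCoeff (f - 1) = 0 := by simp [hf]
  have h2 := constantCoeff_subst_eq_zero (a := f - 1) hf0 _ h
  have h3 : (PowerSeries.binomialSeries ℂ a - 1).subst (f - 1) = cpow f a - 1 := by
    rw [subst_sub (hasSubst_sub_one hf), cpow, ← coe_substAlgHom (hasSubst_sub_one hf), map_one]
  rw [h3] at h2
  have h4 : constantCoeff (cpow f a - 1) = 0 := h2
  simpa [sub_eq_zero] using h4

lemma cpow_add {f : ℂ⟦X⟧} (hf : constantCoeff f = 1) (a b : ℂ) :
    cpow f (a + b) = cpow f a * cpow f b := by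
  simp [cpow, subst_mul (hasSubst_sub_one hf)]

lemma cpow_zero (f : ℂ⟦X⟧) (hf : constantCoeff f = 1) : cpow f 0 = 1 := by
  rw [cpow, binomialSeries_zero, ← coe_substAlgHom (hasSubst_sub_one hf), map_one]

lemma cpow_natCast {f : ℂ⟦X⟧} (hf : constantCoeff f = 1) (n : ℕ) : cpow f n = f ^ n := by
  rw [cpow, binomialSeries_nat, ← coe_substAlgHom (hasSubst_sub_one hf), map_pow, map_add, map_one,
    coe_substAlgHom, subst_X (hasSubst_sub_one hf)]
  ring

lemma cpow_one {f : ℂ⟦X⟧} (hf : constantCoeff f = 1) : cpow f 1 = f := by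
  simpa using cpow_natCast hf 1

lemma cpow_mul_cpow_neg {f : ℂ⟦X⟧} (hf : constantCoeff f = 1) (a : ℂ) :
    cpow f a * cpow f (-a) = 1 := by
  rw [← cpow_add hf, add_neg_cancel, cpow_zero f hf]

lemma succ_mul_choose_succ (a : ℂ) (n : ℕ) :
    ((n : ℂ) + 1) * Ring.choose a (n + 1) = (a - n) * Ring.choose a n := by
  have h := Ring.descPochhammer_eq_factorial_smul_choose a (n + 1)
  rw [descPochhammer_succ_right, Polynomial.smeval_mul,
    Ring.descPochhammer_eq_factorial_smul_choose] at h
  have hn : (n.factorial : ℂ) ≠ 0 := by exact_mod_cast n.factorial_ne_zero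
  simp [Nat.factorial_succ, Polynomial.smeval_sub, Polynomial.smeval_natCast] at h
  apply mul_left_cancel₀ hn
  linear_combination -h

lemma derivative_binomialSeries (a : ℂ) :
    (1 + X) * d⁄dX ℂ (PowerSeries.binomialSeries ℂ a) = C a * PowerSeries.binomialSeries ℂ a := by
  ext n
  rw [add_mul, one_mul, map_add, coeff_C_mul]
  rcases n with _ | n
  · simp [coeff_derivative]
  · rw [coeff_succ_X_mul, coeff_derivative, coeff_derivative]
    have h := succ_mul_choose_succ a (n + 1)
    simp only [binomialSeries_coeff, smul_eq_mul, mul_one]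
    push_cast at h ⊢
    linear_combination h

lemma mul_derivative_cpow {f : ℂ⟦X⟧} (hf : constantCoeff f = 1) (a : ℂ) :
    f * d⁄dX ℂ (cpow f a) = C a * d⁄dX ℂ f * cpow f a := by
  have hs := hasSubst_sub_one hf
  have h := congrArg (PowerSeries.subst (f - 1)) (derivative_binomialSeries a)
  have hC : (C a : ℂ⟦X⟧).subst (f - 1) = (C a : ℂ⟦X⟧) := subst_C a
  have hX : (1 + X : ℂ⟦X⟧).subst (f - 1) = f := by
    rw [subst_add hs, subst_X hs, ← coe_substAlgHom hs, map_one]; ring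
  rw [subst_mul hs, subst_mul hs, hX, hC] at h
  rw [cpow, derivative_subst hs, map_sub, derivative_one, sub_zero, ← mul_assoc, h]
  ring

/-- `cpow f a` is the only solution with constant coefficient `1` of `f y' = a f' y`. -/
lemma eq_cpow_of_derivative {f y : ℂ⟦X⟧} (hf : constantCoeff f = 1) {a : ℂ}
    (hy : constantCoeff y = 1) (h : f * d⁄dX ℂ y = C a * d⁄dX ℂ f * y) : y = cpow f a := by
  have hf0 : f ≠ 0 := by rintro rfl; simp at hf
  -- The quotient of two solutions has zero derivative, hence equals its constant term.
  have key : y * cpow f (-a) = 1 := by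
    apply derivative.ext
    · apply mul_left_cancel₀ hf0
      rw [Derivation.leibniz, derivative_one, smul_eq_mul, smul_eq_mul]
      have h2 := mul_derivative_cpow hf (-a)
      rw [map_neg] at h2
      linear_combination y * h2 + cpow f (-a) * h
    · simp [hy, constantCoeff_cpow hf]
  linear_combination cpow f a * key - y * cpow_mul_cpow_neg hf a

lemma cpow_cpow {f : ℂ⟦X⟧} (hf : constantCoeff f = 1) (a b : ℂ) :
    cpow (cpow f a) b = cpow f (a * b) := by
  refine eq_cpow_of_derivative hf (constantCoeff_cpow (constantCoeff_cpow hf a) b) ?_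
  have hg := constantCoeff_cpow hf a
  have h0 : cpow f a ≠ 0 := by intro h; simp [h] at hg
  apply mul_left_cancel₀ h0
  have h1 := mul_derivative_cpow hf a
  have h2 := mul_derivative_cpow hg b
  rw [map_mul]
  linear_combination f * h2 + C b * cpow (cpow f a) b * h1

lemma mul_cpow {f g : ℂ⟦X⟧} (hf : constantCoeff f = 1) (hg : constantCoeff g = 1) (a : ℂ) :
    cpow (f * g) a = cpow f a * cpow g a := by
  symm
  refine eq_cpow_of_derivative (by simp [hf, hg])
    (by simp [constantCoeff_cpow hf, constantCoeff_cpow hg]) ?_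
  have h1 := mul_derivative_cpow hf a
  have h2 := mul_derivative_cpow hg a
  simp only [Derivation.leibniz, smul_eq_mul]
  linear_combination f * cpow f a * h2 + g * cpow g a * h1

lemma cpow_inv {f : ℂ⟦X⟧} (hf : constantCoeff f = 1) (a : ℂ) : cpow f⁻¹ a = cpow f (-a) := by
  have hi : constantCoeff f⁻¹ = 1 := by simp [hf]
  have h : f * f⁻¹ = 1 := PowerSeries.mul_inv_cancel f (by simp [hf])
  have h2 := mul_cpow hf hi a
  have h3 : cpow (1 : ℂ⟦X⟧) a = 1 := by
    symm; refine eq_cpow_of_derivative (by simp) (by simp) (by simp)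
  rw [h, h3] at h2
  linear_combination (-cpow f (-a)) * h2 - cpow f⁻¹ a * cpow_mul_cpow_neg hf a

lemma cpow_subst {f y : ℂ⟦X⟧} (hf : constantCoeff f = 1) (hy : constantCoeff y = 0) (a : ℂ) :
    (cpow f a).subst y = cpow (f.subst y) a := by
  have hs : HasSubst y := HasSubst.of_constantCoeff_zero' hy
  rw [cpow, cpow, subst_comp_subst_apply (hasSubst_sub_one hf) hs, subst_sub hs]
  congr 2
  rw [← coe_substAlgHom hs, map_one]

/-! ### The hypergeometric differential equation and a quadratic transformation -/

/-- Compare coefficients of `Xⁿ`; `n = 0, 1` are separate because the term `X² F''` starts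
contributing at `n = 2`. -/
lemma hypergeometric_ode_iff (a b c : ℂ) (F : ℂ⟦X⟧) :
    X * (1 - X) * d⁄dX ℂ (d⁄dX ℂ F) + (C c - C (a + b + 1) * X) * d⁄dX ℂ F - C (a * b) * F = 0 ↔
      ∀ n : ℕ, ((n : ℂ) + 1) * (c + n) * coeff (n + 1) F = (a + n) * (b + n) * coeff n F := by
  have e : X * (1 - X) * d⁄dX ℂ (d⁄dX ℂ F) + (C c - C (a + b + 1) * X) * d⁄dX ℂ F - C (a * b) * F
      = X * d⁄dX ℂ (d⁄dX ℂ F) - X * (X * d⁄dX ℂ (d⁄dX ℂ F)) + C c * d⁄dX ℂ F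
        - C (a + b + 1) * (X * d⁄dX ℂ F) - C (a * b) * F := by ring
  rw [e, PowerSeries.ext_iff]
  refine forall_congr' fun n => ?_
  simp only [map_sub, map_add (coeff n), coeff_C_mul, map_zero]
  rcases n with _ | _ | n
  · simp only [coeff_zero_X_mul, coeff_derivative, Nat.cast_zero, zero_add]
    constructor <;> intro h <;> linear_combination h
  · rw [coeff_succ_X_mul, coeff_succ_X_mul, coeff_succ_X_mul]
    simp only [coeff_zero_X_mul, coeff_derivative]
    push_cast
    constructor <;> intro h <;> linear_combination h
  · rw [coeff_succ_X_mul, coeff_succ_X_mul, coeff_succ_X_mul, coeff_succ_X_mul]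
    simp only [coeff_derivative]
    push_cast
    constructor <;> intro h <;> linear_combination h

lemma add_natCast_ne_zero {c : ℂ} (hc : ∀ k : ℕ, c ≠ -(k : ℂ)) (k : ℕ) : c + k ≠ 0 :=
  fun h => hc k (eq_neg_of_add_eq_zero_left h)

lemma ascPochhammer_eval_ne_zero {c : ℂ} (hc : ∀ k : ℕ, c ≠ -(k : ℂ)) (n : ℕ) :
    (ascPochhammer ℂ n).eval c ≠ 0 := by
  induction n with
  | zero => simp
  | succ n ih =>
    rw [ascPochhammer_succ_eval]
    exact mul_ne_zero ih (add_natCast_ne_zero hc n)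

lemma coeff_succ_hypSeries (a b : ℂ) {c : ℂ} (hc : ∀ k : ℕ, c ≠ -(k : ℂ)) (n : ℕ) :
    ((n : ℂ) + 1) * (c + n) * coeff (n + 1) (hypSeries a b c) =
      (a + n) * (b + n) * coeff n (hypSeries a b c) := by
  have h1 := add_natCast_ne_zero hc n
  have h2 := ascPochhammer_eval_ne_zero hc n
  have h3 : (n.factorial : ℂ) ≠ 0 := by exact_mod_cast n.factorial_ne_zero
  have h4 : (n : ℂ) + 1 ≠ 0 := n.cast_add_one_ne_zero
  simp only [hypSeries, coeff_mk, ordinaryHypergeometricCoefficient, ascPochhammer_succ_eval,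
    Nat.factorial_succ]
  push_cast
  field_simp

lemma hypSeries_ode (a b : ℂ) {c : ℂ} (hc : ∀ k : ℕ, c ≠ -(k : ℂ)) :
    X * (1 - X) * d⁄dX ℂ (d⁄dX ℂ (hypSeries a b c)) +
      (C c - C (a + b + 1) * X) * d⁄dX ℂ (hypSeries a b c) - C (a * b) * hypSeries a b c = 0 :=
  (hypergeometric_ode_iff a b c _).2 (coeff_succ_hypSeries a b hc)

lemma constantCoeff_hypSeries (a b c : ℂ) : constantCoeff (hypSeries a b c) = 1 := by
  rw [← coeff_zero_eq_constantCoeff_apply]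
  simp [hypSeries, ordinaryHypergeometricCoefficient]

lemma eq_hypSeries_of_ode {a b c : ℂ} (hc : ∀ k : ℕ, c ≠ -(k : ℂ)) {F : ℂ⟦X⟧}
    (hF : constantCoeff F = 1)
    (h : X * (1 - X) * d⁄dX ℂ (d⁄dX ℂ F) + (C c - C (a + b + 1) * X) * d⁄dX ℂ F -
      C (a * b) * F = 0) : F = hypSeries a b c := by
  rw [hypergeometric_ode_iff] at h
  ext n
  induction n with
  | zero => simp [hF, constantCoeff_hypSeries]
  | succ n ih =>
    have h1 : ((n : ℂ) + 1) * (c + n) ≠ 0 :=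
      mul_ne_zero n.cast_add_one_ne_zero (add_natCast_ne_zero hc n)
    apply mul_left_cancel₀ h1
    rw [h, coeff_succ_hypSeries a b hc, ih]

lemma constantCoeff_subst_of_zero (F : ℂ⟦X⟧) {y : ℂ⟦X⟧} (hy : constantCoeff y = 0) :
    constantCoeff (F.subst y : ℂ⟦X⟧) = constantCoeff F := by
  have hs : HasSubst y := HasSubst.of_constantCoeff_zero' hy
  have h : constantCoeff (F - C (constantCoeff F)) = 0 := by simp
  have h2 := constantCoeff_subst_eq_zero (a := y) hy _ h
  have hC : (C (constantCoeff F) : ℂ⟦X⟧).subst y = (C (constantCoeff F) : ℂ⟦X⟧) := subst_C _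
  rw [subst_sub hs, hC] at h2
  have h4 : constantCoeff (F.subst y - C (constantCoeff F) : ℂ⟦X⟧) = 0 := h2
  simpa [sub_eq_zero] using h4

/-- The right side has constant term `1` and solves the hypergeometric equation of the left side.
With `v = (1-2X)⁻¹` one has `v' = 2v²`, so its derivatives are polynomial in `v` times the
pulled-back derivatives `K0`, `K1`, `K2`. -/
lemma hypSeries_eq_quadratic {a b c : ℂ} (hc : ∀ k : ℕ, c ≠ -(k : ℂ)) (habc : a + b + 1 = 2 * c) :
    hypSeries a b c = cpow (1 - 2 * X) (-a) *
      hypSubst (a / 2) (a / 2 + 1 / 2) c (1 - ((1 - 2 * X)⁻¹) ^ 2) := by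
  symm
  set v : ℂ⟦X⟧ := (1 - 2 * X)⁻¹ with hv
  have hg : constantCoeff (1 - 2 * X : ℂ⟦X⟧) = 1 := by simp
  have hv1 : (1 - 2 * X) * v = 1 := PowerSeries.mul_inv_cancel _ (by simp [hg])
  have hvc : constantCoeff v = 1 := by simp [hv]
  have hz : constantCoeff (1 - v ^ 2) = 0 := by simp [hvc]
  have hs : HasSubst (1 - v ^ 2) := HasSubst.of_constantCoeff_zero' hz
  have hdg : d⁄dX ℂ (1 - 2 * X : ℂ⟦X⟧) = -2 := by
    have : (2 : ℂ⟦X⟧) = C (2 : ℂ) := (map_ofNat C 2).symm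
    rw [map_sub, derivative_one, this, derivative_C_mul, derivative_X]; simp
  have hdv : d⁄dX ℂ v = 2 * v ^ 2 := by rw [hv, derivative_inv', hdg]; ring
  have hcp : cpow (1 - 2 * X) (-a) = cpow v a := by rw [hv, cpow_inv hg]
  set P := cpow v a with hP
  have hdP : d⁄dX ℂ P = C a * 2 * v * P := by
    have h := mul_derivative_cpow hvc a
    rw [hdv] at h
    have hv0 : v ≠ 0 := by intro h; simp [h] at hvc
    apply mul_left_cancel₀ hv0
    rw [h]; ring
  set K0 := hypSubst (a / 2) (a / 2 + 1 / 2) c (1 - v ^ 2) with hK0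
  set K1 : ℂ⟦X⟧ := (d⁄dX ℂ (hypSeries (a / 2) (a / 2 + 1 / 2) c)).subst (1 - v ^ 2) with hK1
  set K2 : ℂ⟦X⟧ :=
    (d⁄dX ℂ (d⁄dX ℂ (hypSeries (a / 2) (a / 2 + 1 / 2) c))).subst (1 - v ^ 2) with hK2
  have hdz : d⁄dX ℂ (1 - v ^ 2) = - 4 * v ^ 3 := by
    rw [map_sub, derivative_one, derivative_pow, hdv]; push_cast; ring
  have hd0 : d⁄dX ℂ K0 = K1 * (- 4 * v ^ 3) := by rw [hK0, hypSubst, derivative_subst hs, hdz]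
  have hd1 : d⁄dX ℂ K1 = K2 * (- 4 * v ^ 3) := by rw [hK1, derivative_subst hs, hdz]
  have ode : (1 - v ^ 2) * v ^ 2 * K2 + (C c - C (a + 3 / 2) * (1 - v ^ 2)) * K1 -
      C (a / 2 * (a / 2 + 1 / 2)) * K0 = 0 := by
    have h := congrArg (PowerSeries.subst (1 - v ^ 2))
      (hypSeries_ode (a / 2) (a / 2 + 1 / 2) hc)
    have hC : ∀ r : ℂ, (C r : ℂ⟦X⟧).subst (1 - v ^ 2) = (C r : ℂ⟦X⟧) := fun r => subst_C r
    have h1 : (1 : ℂ⟦X⟧).subst (1 - v ^ 2) = (1 : ℂ⟦X⟧) := by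
      rw [← coe_substAlgHom hs, map_one]
    have h0 : (0 : ℂ⟦X⟧).subst (1 - v ^ 2) = (0 : ℂ⟦X⟧) := by
      rw [← coe_substAlgHom hs, map_zero]
    simp only [subst_mul hs, subst_add hs, subst_sub hs, hC, subst_X hs, h1, h0] at h
    rw [show a / 2 + (a / 2 + 1 / 2) + 1 = a + 3 / 2 by ring] at h
    rw [hK0, hypSubst, hK1, hK2, ← h]
    ring
  rw [hcp]
  refine eq_hypSeries_of_ode hc ?_ ?_
  · rw [map_mul, constantCoeff_cpow hvc, hK0, hypSubst, constantCoeff_subst_of_zero _ hz,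
      constantCoeff_hypSeries, one_mul]
  have hb : b = 2 * c - a - 1 := by linear_combination habc
  have h2 : (C (2 : ℂ) : ℂ⟦X⟧) = 2 := map_ofNat C 2
  have hda : ∀ f : ℂ⟦X⟧, d⁄dX ℂ (C a * 2 * f) = C a * 2 * d⁄dX ℂ f := by
    intro f; rw [← h2, ← map_mul, derivative_C_mul]
  have hd4 : ∀ f : ℂ⟦X⟧, d⁄dX ℂ (-4 * f) = -4 * d⁄dX ℂ f := by
    intro f
    have : (-4 : ℂ⟦X⟧) = C (-4 : ℂ) := by rw [map_neg, map_ofNat]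
    rw [this, derivative_C_mul]
  have first : d⁄dX ℂ (P * K0) = C a * 2 * (v * P * K0) + -4 * (v ^ 3 * P * K1) := by
    rw [Derivation.leibniz, hdP, hd0]; simp only [smul_eq_mul]; ring
  have second : d⁄dX ℂ (d⁄dX ℂ (P * K0)) =
      4 * C a * (C a + 1) * v ^ 2 * P * K0 - (16 * C a + 24) * v ^ 4 * P * K1
        + 16 * v ^ 6 * P * K2 := by
    rw [first, map_add, hda, hd4]
    simp only [Derivation.leibniz, derivative_pow, hdP, hd0, hd1, hdv, smul_eq_mul]
    push_cast
    ring
  rw [second, first, hb]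
  have e1 : (C (a + (2 * c - a - 1) + 1) : ℂ⟦X⟧) = 2 * C c := by
    rw [← h2, ← map_mul]; congr 1; ring
  have e2 : (C (a * (2 * c - a - 1)) : ℂ⟦X⟧) = C a * (2 * C c - C a - 1) := by
    simp only [map_mul, map_sub, map_one, h2]
  have e3 : 2 * (C (a + 3 / 2) : ℂ⟦X⟧) = 2 * C a + 3 := by
    rw [← h2, ← map_mul, ← map_mul]
    rw [show (3 : ℂ⟦X⟧) = C (3 : ℂ) from (map_ofNat C 3).symm, ← map_add]; congr 1; ring
  have e4 : 4 * (C (a / 2 * (a / 2 + 1 / 2)) : ℂ⟦X⟧) = C a * (C a + 1) := by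
    rw [show (4 : ℂ⟦X⟧) = C (4 : ℂ) from (map_ofNat C 4).symm, ← map_one (C : ℂ →+* ℂ⟦X⟧), ← map_mul, ← map_add,
      ← map_mul]
    congr 1; ring
  rw [e1, e2]
  -- This eliminates `X` in favour of `v`; the factor `4` below clears the denominators of
  -- `(a/2)(a/2 + 1/2)`.
  have hX : 2 * X * v = v - 1 := by linear_combination - hv1
  apply mul_left_cancel₀ (show (4 : ℂ⟦X⟧) ≠ 0 by
    rw [show (4 : ℂ⟦X⟧) = C (4 : ℂ) from (map_ofNat C 4).symm]
    exact fun h => (by norm_num : (4 : ℂ) ≠ 0) (C_injective (h.trans (map_zero C).symm)))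
  have hQ : 4 * X * (1 - X) * v ^ 2 = v ^ 2 - 1 := by
    linear_combination (v + 1 - 2 * X * v) * hX
  rw [mul_zero]
  linear_combination
    P * (4 * C a * (C a + 1) * K0 - (16 * C a + 24) * v ^ 2 * K1 + 16 * v ^ 4 * K2) * hQ
    + 4 * C c * P * (2 * C a * K0 - 4 * v ^ 2 * K1) * hv1
    - 16 * v ^ 2 * P * ode - 8 * v ^ 2 * P * (1 - v ^ 2) * K1 * e3 - 4 * v ^ 2 * P * K0 * e4

lemma hypSubst_eq_quadratic {a b c : ℂ} (hc : ∀ k : ℕ, c ≠ -(k : ℂ)) (habc : a + b + 1 = 2 * c)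
    {y : ℂ⟦X⟧} (hy : constantCoeff y = 0) :
    hypSubst a b c y = cpow (1 - 2 * y) (-a) *
      hypSubst (a / 2) (a / 2 + 1 / 2) c (1 - ((1 - 2 * y)⁻¹) ^ 2) := by
  have hs : HasSubst y := HasSubst.of_constantCoeff_zero' hy
  have hg : constantCoeff (1 - 2 * X : ℂ⟦X⟧) = 1 := by simp
  have h1 : (1 : ℂ⟦X⟧).subst y = (1 : ℂ⟦X⟧) := by rw [← coe_substAlgHom hs, map_one]
  have h2 : (2 : ℂ⟦X⟧).subst y = (2 : ℂ⟦X⟧) := by rw [← coe_substAlgHom hs, map_ofNat]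
  have h3 : (1 - 2 * X : ℂ⟦X⟧).subst y = 1 - 2 * y := by
    rw [subst_sub hs, subst_mul hs, h1, h2, subst_X hs]
  have hy1 : constantCoeff (1 - 2 * y) = 1 := by simp [hy]
  have h4 : ((1 - 2 * X : ℂ⟦X⟧)⁻¹).subst y = (1 - 2 * y)⁻¹ := by
    rw [PowerSeries.eq_inv_iff_mul_eq_one (by simp [hy1]), ← h3, ← subst_mul hs,
      PowerSeries.inv_mul_cancel _ (by simp [hg]), h1]
  have hz : constantCoeff (1 - ((1 - 2 * X : ℂ⟦X⟧)⁻¹) ^ 2) = 0 := by simp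
  rw [hypSubst, hypSeries_eq_quadratic hc habc, subst_mul hs, cpow_subst hg hy, h3, hypSubst,
    subst_comp_subst_apply (HasSubst.of_constantCoeff_zero' hz) hs, subst_sub hs, subst_pow hs,
    h1, h4, hypSubst]

/-! ### The expansion of `exp (p s) ₀F₁(; c; d s ^ 2 / 4)` -/

/-- The coefficients in `s` of `₀F₁(; c; d s ^ 2 / 4)`. -/
def besselCoeff (c : ℂ) (d : ℂ⟦X⟧) (i : ℕ) : ℂ⟦X⟧ :=
  if Even i then
    C ((4 ^ (i / 2) * ((i / 2).factorial : ℂ) * (ascPochhammer ℂ (i / 2)).eval c)⁻¹) * d ^ (i / 2)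
  else 0

lemma besselCoeff_two_mul (c : ℂ) (d : ℂ⟦X⟧) (j : ℕ) :
    besselCoeff c d (2 * j) =
      C ((4 ^ j * (j.factorial : ℂ) * (ascPochhammer ℂ j).eval c)⁻¹) * d ^ j := by
  simp [besselCoeff]

lemma besselCoeff_two_mul_add_one (c : ℂ) (d : ℂ⟦X⟧) (j : ℕ) :
    besselCoeff c d (2 * j + 1) = 0 := by
  simp [besselCoeff]

/-- Coefficient form of `s B'' + 2l B' = d s B`, the equation of `₀F₁(; l+1/2; d s²/4)`. -/
lemma besselCoeff_rec {l : ℂ} (hl : ∀ k : ℕ, l + 1 / 2 ≠ -(k : ℂ)) (d : ℂ⟦X⟧) (i : ℕ) :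
    C (((i : ℂ) + 2) * (i + 1 + 2 * l)) * besselCoeff (l + 1 / 2) d (i + 2) =
      d * besselCoeff (l + 1 / 2) d i := by
  obtain ⟨j, rfl | rfl⟩ := i.even_or_odd'
  · rw [show 2 * j + 2 = 2 * (j + 1) by ring, besselCoeff_two_mul, besselCoeff_two_mul, ← mul_assoc,
      ← map_mul, mul_left_comm, ← pow_succ']
    congr 2
    have h1 := add_natCast_ne_zero hl j
    have h2 := ascPochhammer_eval_ne_zero hl j
    have h3 : (j.factorial : ℂ) ≠ 0 := by exact_mod_cast j.factorial_ne_zero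
    have h4 : (j : ℂ) + 1 ≠ 0 := j.cast_add_one_ne_zero
    rw [ascPochhammer_succ_eval, Nat.factorial_succ, pow_succ, inv_eq_one_div, inv_eq_one_div,
      mul_one_div, div_eq_div_iff]
    · push_cast; ring
    · refine mul_ne_zero (mul_ne_zero (by simp) ?_) (mul_ne_zero h2 h1)
      push_cast; exact mul_ne_zero h4 h3
    · exact mul_ne_zero (mul_ne_zero (by simp) h3) h2
  · rw [show 2 * j + 1 + 2 = 2 * (j + 1) + 1 by ring, besselCoeff_two_mul_add_one,
      besselCoeff_two_mul_add_one, mul_zero, mul_zero]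

/-- The coefficients in `s` of `exp (p s) ₀F₁(; c; d s ^ 2 / 4)`. -/
def expBesselCoeff (c : ℂ) (p d : ℂ⟦X⟧) (n : ℕ) : ℂ⟦X⟧ :=
  ∑ i ∈ Finset.HasAntidiagonal.antidiagonal n, besselCoeff c d i.1 * (C ((i.2.factorial : ℂ)⁻¹) * p ^ i.2)

lemma expBesselCoeff_zero (c : ℂ) (p d : ℂ⟦X⟧) : expBesselCoeff c p d 0 = 1 := by
  simp [expBesselCoeff, besselCoeff]

lemma expBesselCoeff_one (c : ℂ) (p d : ℂ⟦X⟧) : expBesselCoeff c p d 1 = p := by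
  simp [expBesselCoeff, besselCoeff, Finset.Nat.antidiagonal_succ]

/-- Multiplying by `exp(ps)` conjugates `d/ds` to `d/ds - p` in the equation of the `₀F₁` factor;
the recurrence is read off at `s^(n+1)`. Series in `s` have coefficients in `ℂ⟦X⟧`, so `p` and `d`
are constants there. -/
lemma expBesselCoeff_rec {l : ℂ} (hl : ∀ k : ℕ, l + 1 / 2 ≠ -(k : ℂ)) (p d : ℂ⟦X⟧) (n : ℕ) :
    C (((n : ℂ) + 2) * (n + 1 + 2 * l)) * expBesselCoeff (l + 1 / 2) p d (n + 2) =
      C (2 * (n + 1 + l)) * p * expBesselCoeff (l + 1 / 2) p d (n + 1) -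
        (p ^ 2 - d) * expBesselCoeff (l + 1 / 2) p d n := by
  set Ex : ℂ⟦X⟧⟦X⟧ := PowerSeries.mk fun m => C ((m.factorial : ℂ)⁻¹) * p ^ m with hEx
  set B : ℂ⟦X⟧⟦X⟧ := PowerSeries.mk (besselCoeff (l + 1 / 2) d) with hB
  have hE : ∀ k, coeff k (B * Ex) = expBesselCoeff (l + 1 / 2) p d k := by
    intro k
    simp only [coeff_mul, hEx, hB, coeff_mk, expBesselCoeff]
  have dEx : d⁄dX ℂ⟦X⟧ Ex = C p * Ex := by
    ext1 k
    rw [coeff_derivative, coeff_C_mul, hEx, coeff_mk, coeff_mk, pow_succ]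
    have hk : C (((k + 1).factorial : ℂ)⁻¹) * ((k : ℂ⟦X⟧) + 1) = C ((k.factorial : ℂ)⁻¹) := by
      rw [show (k : ℂ⟦X⟧) + 1 = C ((k : ℂ) + 1) by simp, ← map_mul, Nat.factorial_succ]
      congr 1
      have h3 : (k.factorial : ℂ) ≠ 0 := by exact_mod_cast k.factorial_ne_zero
      have h4 : (k : ℂ) + 1 ≠ 0 := k.cast_add_one_ne_zero
      push_cast
      field_simp
    linear_combination p ^ k * p * hk
  have hode : X * d⁄dX ℂ⟦X⟧ (d⁄dX ℂ⟦X⟧ B) + C (C (2 * l)) * d⁄dX ℂ⟦X⟧ B = C d * (X * B) := by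
    ext1 k
    rw [map_add, coeff_C_mul, coeff_C_mul]
    rcases k with _ | k
    · have : besselCoeff (l + 1 / 2) d 1 = 0 := besselCoeff_two_mul_add_one _ _ 0
      rw [coeff_zero_X_mul, coeff_zero_X_mul, coeff_derivative, hB, coeff_mk, this]
      simp
    · have h := besselCoeff_rec hl d k
      rw [coeff_succ_X_mul, coeff_succ_X_mul, coeff_derivative, coeff_derivative, hB, coeff_mk,
        coeff_mk, ← h]
      simp only [map_mul, map_add, map_natCast, map_ofNat, map_one]
      push_cast
      ring
  have hEode : X * d⁄dX ℂ⟦X⟧ (d⁄dX ℂ⟦X⟧ (B * Ex)) + C (C (2 * l)) * d⁄dX ℂ⟦X⟧ (B * Ex) =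
      C (2 * p) * (X * d⁄dX ℂ⟦X⟧ (B * Ex)) + C (C (2 * l) * p) * (B * Ex)
        - C (p ^ 2 - d) * (X * (B * Ex)) := by
    simp only [Derivation.leibniz, map_add, dEx, smul_eq_mul, derivative_C, map_mul, map_sub,
      map_pow, map_ofNat]
    simp only [map_mul, map_ofNat] at hode
    linear_combination Ex * hode
  have h := congrArg (coeff (n + 1)) hEode
  rw [map_add, map_sub, map_add, coeff_C_mul, coeff_C_mul, coeff_C_mul, coeff_C_mul,
    coeff_succ_X_mul, coeff_succ_X_mul, coeff_succ_X_mul, coeff_derivative, coeff_derivative,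
    coeff_derivative, hE, hE, hE] at h
  simp only [map_mul, map_add, map_natCast, map_ofNat, map_one] at h ⊢
  push_cast at h
  linear_combination h

lemma ascPochhammer_eval_add (w : ℂ) (i m : ℕ) :
    (ascPochhammer ℂ (i + m)).eval w =
      (ascPochhammer ℂ i).eval w * (ascPochhammer ℂ m).eval (w + i) := by
  rw [← ascPochhammer_mul]
  simp

lemma ascPochhammer_eval_two_mul (w : ℂ) (j : ℕ) :
    (ascPochhammer ℂ (2 * j)).eval w =
      4 ^ j * (ascPochhammer ℂ j).eval (w / 2) * (ascPochhammer ℂ j).eval (w / 2 + 1 / 2) := by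
  induction j with
  | zero => simp
  | succ j ih =>
    rw [show 2 * (j + 1) = 2 * j + 1 + 1 by ring, ascPochhammer_succ_eval, ascPochhammer_succ_eval,
      ih, ascPochhammer_succ_eval, ascPochhammer_succ_eval]
    push_cast
    ring

lemma choose_neg_eq (v : ℂ) (m : ℕ) :
    Ring.choose (-v) m = (-1) ^ m * ((m.factorial : ℂ)⁻¹ * (ascPochhammer ℂ m).eval v) := by
  induction m with
  | zero => simp
  | succ m ih =>
    have h4 : (m : ℂ) + 1 ≠ 0 := m.cast_add_one_ne_zero
    have h3 : (m.factorial : ℂ) ≠ 0 := by exact_mod_cast m.factorial_ne_zero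
    apply mul_left_cancel₀ h4
    rw [succ_mul_choose_succ, ih, ascPochhammer_succ_eval, Nat.factorial_succ]
    push_cast
    field_simp
    ring

/-! ### Summation against rising factorials -/

lemma hasSum_of_forall_eq {ι M : Type*} [AddCommMonoid M] [TopologicalSpace M] {f g : ι → M}
    {s : M} (hg : HasSum g s)
    (h : ∀ i, f i = g i) : HasSum f s :=
  (funext h : f = g) ▸ hg

lemma hasSum_cpow_one_sub {f : ℂ⟦X⟧} (hf : constantCoeff f = 0) (v : ℂ) :
    HasSum (fun m : ℕ => C ((m.factorial : ℂ)⁻¹ * (ascPochhammer ℂ m).eval v) * f ^ m)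
      (cpow (1 - f) (-v)) := by
  have h := hasSum_subst (PowerSeries.binomialSeries ℂ (-v)) (f := -f) (by simp [hf])
  have e : cpow (1 - f) (-v) = (PowerSeries.binomialSeries ℂ (-v)).subst (-f) := by
    rw [cpow]; congr 1; ring
  rw [e]
  convert h using 1
  funext m
  rw [binomialSeries_coeff, choose_neg_eq, smul_eq_mul, mul_one, neg_pow f, map_mul C ((-1) ^ m),
    map_pow, map_neg, map_one, mul_mul_mul_comm, mul_comm ((-1 : ℂ⟦X⟧) ^ m), mul_assoc,
    mul_left_comm, ← mul_assoc ((-1 : ℂ⟦X⟧) ^ m), ← mul_pow]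
  simp

lemma summable_expBessel_terms {f : ℂ⟦X⟧} (hf : constantCoeff f = 0) (g : ℕ × ℕ → ℂ⟦X⟧) :
    Summable fun i : ℕ × ℕ => f ^ (i.1 + i.2) * g i := by
  rw [PowerSeries.WithPiTopology.summable_iff_summable_coeff]
  intro d
  refine summable_of_ne_finset_zero (s := Finset.range (d + 1) ×ˢ Finset.range (d + 1)) ?_
  rintro ⟨i, m⟩ him
  have hd : d < i + m := by
    simp only [Finset.mem_product, Finset.mem_range] at him
    omega
  have h1 : (X : ℂ⟦X⟧) ^ (i + m) ∣ f ^ (i + m) * g (i, m) :=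
    (pow_dvd_pow_of_dvd (X_dvd_iff.2 hf) _).mul_right _
  exact X_pow_dvd_iff.1 h1 d hd

/-- Sum one double family two ways: along `i + m = k`, or over `m` for fixed `i`. The latter uses
`(w)_{i+m} = (w)_i (w+i)_m` and the binomial series. -/
lemma hasSum_expBesselCoeff (c w : ℂ) (p d : ℂ⟦X⟧) {f : ℂ⟦X⟧} (hf : constantCoeff f = 0) :
    HasSum (fun k => C ((ascPochhammer ℂ k).eval w) * f ^ k * expBesselCoeff c p d k)
      (cpow (1 - f * p) (-w) *
        hypSubst (w / 2) (w / 2 + 1 / 2) c (d * f ^ 2 * ((1 - f * p)⁻¹) ^ 2)) := by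
  set g : ℕ × ℕ → ℂ⟦X⟧ := fun i => C ((ascPochhammer ℂ (i.1 + i.2)).eval w) *
    (besselCoeff c d i.1 * (C ((i.2.factorial : ℂ)⁻¹) * p ^ i.2)) with hg
  obtain ⟨s, hs⟩ := summable_expBessel_terms hf g
  have hfp : constantCoeff (f * p) = 0 := by simp [hf]
  have h1 : constantCoeff (1 - f * p) = 1 := by simp [hf]
  have hinv : ∀ v : ℂ, ∀ j : ℕ, cpow (1 - f * p) (-(v + j)) =
      cpow (1 - f * p) (-v) * ((1 - f * p)⁻¹) ^ j := by
    intro v j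
    rw [neg_add, cpow_add h1, ← cpow_inv h1 j, cpow_natCast (by simp [hf])]
  have left : HasSum (fun k => C ((ascPochhammer ℂ k).eval w) * f ^ k * expBesselCoeff c p d k)
      s := by
    refine ((Finset.HasAntidiagonal.sigmaAntidiagonalEquivProd (A := ℕ)).hasSum_iff.2 hs).sigma
      fun k => ?_
    have := Finset.hasSum (Finset.HasAntidiagonal.antidiagonal k) fun i : ℕ × ℕ => f ^ (i.1 + i.2) * g i
    have e : C ((ascPochhammer ℂ k).eval w) * f ^ k * expBesselCoeff c p d k =
        ∑ i ∈ Finset.HasAntidiagonal.antidiagonal k, f ^ (i.1 + i.2) * g i := by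
      rw [expBesselCoeff, Finset.mul_sum]
      refine Finset.sum_congr rfl fun i hi => ?_
      rw [hg, ← Finset.HasAntidiagonal.mem_antidiagonal.1 hi]
      ring
    rw [e]
    exact this
  have right : HasSum (fun i => C ((ascPochhammer ℂ i).eval w) * f ^ i * besselCoeff c d i *
      cpow (1 - f * p) (-(w + i))) s := by
    refine hs.prod_fiberwise fun i => ?_
    refine hasSum_of_forall_eq ((hasSum_cpow_one_sub hfp (w + i)).mul_left
      (C ((ascPochhammer ℂ i).eval w) * f ^ i * besselCoeff c d i)) fun m => ?_
    simp only [hg, ascPochhammer_eval_add, map_mul]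
    ring
  have hz : constantCoeff (d * f ^ 2 * ((1 - f * p)⁻¹) ^ 2) = 0 := by simp [hf]
  have right' : HasSum (fun i => C ((ascPochhammer ℂ i).eval w) * f ^ i * besselCoeff c d i *
      cpow (1 - f * p) (-(w + i))) (cpow (1 - f * p) (-w) *
        hypSubst (w / 2) (w / 2 + 1 / 2) c (d * f ^ 2 * ((1 - f * p)⁻¹) ^ 2)) := by
    -- Only even `i = 2j` survive; `(w)_{2j} = 4ʲ (w/2)_j (w/2+1/2)_j` cancels the `4ʲ` in the
    -- Bessel coefficient.
    have hinj : Function.Injective (fun j : ℕ => 2 * j) := fun a b h => by simpa using h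
    rw [← hinj.hasSum_iff]
    · refine hasSum_of_forall_eq ((hasSum_subst (hypSeries (w / 2) (w / 2 + 1 / 2) c) hz).mul_left
        (cpow (1 - f * p) (-w))) fun j => ?_
      simp only [Function.comp, besselCoeff_two_mul, hinv, ascPochhammer_eval_two_mul, hypSeries,
        coeff_mk, ordinaryHypergeometricCoefficient]
      have e : ∀ A B F K : ℂ, C (4 ^ j * A * B) * (C ((4 ^ j * F * K)⁻¹) : ℂ⟦X⟧) =
          C (F⁻¹ * A * B * K⁻¹) := by
        intro A B F K
        rw [← map_mul]
        congr 1
        have : (4 : ℂ) ^ j ≠ 0 := by simp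
        rw [mul_inv, mul_inv]
        field_simp
      rw [← e]
      ring
    · intro i hi
      obtain ⟨j, rfl | rfl⟩ := i.even_or_odd'
      · exact absurd ⟨j, rfl⟩ hi
      · simp [besselCoeff_two_mul_add_one]
  rwa [right.unique right'] at left

/-! ### Gegenbauer polynomials and the generating function -/

lemma map_cpow {f : (Polynomial ℂ)⟦X⟧} (hf : constantCoeff f = 1) (x a : ℂ) :
    PowerSeries.map (Polynomial.evalRingHom x) (cpow f a) =
      cpow (PowerSeries.map (Polynomial.evalRingHom x) f) a := by
  have h := map_subst (hasSubst_sub_one hf) (h := Polynomial.evalRingHom x)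
    (PowerSeries.binomialSeries (Polynomial ℂ) a)
  have h2 : PowerSeries.map (Polynomial.evalRingHom x) (cpow f a) =
      (PowerSeries.map (Polynomial.evalRingHom x)
        (PowerSeries.binomialSeries (Polynomial ℂ) a)).subst
      (PowerSeries.map (Polynomial.evalRingHom x) (f - 1)) := h
  rw [h2, cpow, map_sub, map_one]
  congr 1
  ext n
  simp

lemma gegenbauer_eval (l x : ℂ) (n : ℕ) :
    (gegenbauer l n).eval x = coeff n (cpow (1 - 2 * C x * X + X ^ 2) (-l)) := by
  have h := map_cpow (f := 1 - 2 * C (Polynomial.X : Polynomial ℂ) * X + X ^ 2) (by simp) x (-l)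
  rw [map_add, map_sub, map_mul, map_mul, map_pow, map_one, map_ofNat, map_C, map_X,
    Polynomial.coe_evalRingHom, Polynomial.eval_X] at h
  rw [← h, coeff_map, Polynomial.coe_evalRingHom, gegenbauer]

lemma derivative_one_sub_two_mul_add_sq (x : ℂ) :
    d⁄dX ℂ (1 - 2 * C x * X + X ^ 2 : ℂ⟦X⟧) = - (2 * (C x - X)) := by
  have h : (1 - 2 * C x * X + X ^ 2 : ℂ⟦X⟧) = 1 - C (2 * x) * X + X ^ 2 := by
    rw [map_mul, map_ofNat]
  rw [h, map_add, map_sub, derivative_one, derivative_pow, derivative_C_mul, derivative_X, map_mul,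
    map_ofNat]
  push_cast
  ring

/-- Repeated differentiation of `Q G' = 2l (x - t) G`. -/
lemma mul_iterate_derivative_cpow (l x : ℂ) (k : ℕ) :
    (1 - 2 * C x * X + X ^ 2) * (d⁄dX ℂ)^[k + 2] (cpow (1 - 2 * C x * X + X ^ 2) (-l)) =
      C (2 * (k + 1 + l)) * (C x - X) *
          (d⁄dX ℂ)^[k + 1] (cpow (1 - 2 * C x * X + X ^ 2) (-l)) -
        C ((k + 1) * (k + 2 * l)) * (d⁄dX ℂ)^[k] (cpow (1 - 2 * C x * X + X ^ 2) (-l)) := by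
  set Q : ℂ⟦X⟧ := 1 - 2 * C x * X + X ^ 2 with hQ
  set G := cpow Q (-l) with hG
  have hdQ : d⁄dX ℂ Q = - (2 * (C x - X)) := derivative_one_sub_two_mul_add_sq x
  have hdl : d⁄dX ℂ (C x - X) = -1 := by simp
  have h1 : Q * d⁄dX ℂ G = C (2 * l) * (C x - X) * G := by
    rw [hG, mul_derivative_cpow (by simp [hQ]), hdQ]
    simp only [map_neg, map_mul, map_ofNat]
    ring
  induction k with
  | zero =>
    have h := congrArg (d⁄dX ℂ) h1
    simp only [Derivation.leibniz, smul_eq_mul, hdQ, hdl, derivative_C] at h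
    simp only [Function.iterate_succ, Function.comp, Function.iterate_zero, id, Nat.cast_zero]
    simp only [map_mul, map_add, map_ofNat, map_one, map_zero] at h ⊢
    linear_combination h
  | succ k ih =>
    have h := congrArg (d⁄dX ℂ) ih
    simp only [Derivation.leibniz, smul_eq_mul, hdQ, hdl, derivative_C, map_sub,
      ← Function.iterate_succ_apply' (d⁄dX ℂ)] at h
    push_cast
    simp only [map_mul, map_add, map_ofNat, map_one, map_natCast] at h ⊢
    linear_combination h

/-- Both sides agree for `k = 0, 1` and obey the same three-term recurrence, since `p² - d = q` for
the chosen `d`. -/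
lemma iterate_derivative_cpow {l : ℂ} (hl : ∀ k : ℕ, l + 1 / 2 ≠ -(k : ℂ)) (x : ℂ) {q : ℂ⟦X⟧}
    (hq : (1 - 2 * C x * X + X ^ 2) * q = 1) (k : ℕ) :
    (d⁄dX ℂ)^[k] (cpow (1 - 2 * C x * X + X ^ 2) (-l)) =
      cpow (1 - 2 * C x * X + X ^ 2) (-l) *
        (C ((k.factorial : ℂ) * (ascPochhammer ℂ k).eval (2 * l)) *
          expBesselCoeff (l + 1 / 2) ((C x - X) * q) (((C x - X) * q) ^ 2 - q) k) := by
  set Q : ℂ⟦X⟧ := 1 - 2 * C x * X + X ^ 2 with hQ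
  have hQ0 : Q ≠ 0 := left_ne_zero_of_mul_eq_one hq
  induction k using Nat.twoStepInduction with
  | zero => simp [expBesselCoeff_zero]
  | one =>
    have hdQ : d⁄dX ℂ Q = - (2 * (C x - X)) := derivative_one_sub_two_mul_add_sq x
    apply mul_left_cancel₀ hQ0
    rw [Function.iterate_one, mul_derivative_cpow (by simp [hQ]), hdQ, expBesselCoeff_one]
    simp only [map_neg, map_mul, map_ofNat, ascPochhammer_one, Polynomial.eval_X,
      Nat.factorial_one, Nat.cast_one, map_one]
    linear_combination (-2 * C l * (C x - X) * cpow Q (-l)) * hq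
  | more k ih0 ih1 =>
    apply mul_left_cancel₀ hQ0
    have h := mul_iterate_derivative_cpow l x k
    rw [← hQ] at h
    rw [h, ih0, ih1]
    have hr := expBesselCoeff_rec hl ((C x - X) * q) (((C x - X) * q) ^ 2 - q) k
    simp only [ascPochhammer_succ_eval, Nat.factorial_succ]
    push_cast
    simp only [map_mul, map_add, map_ofNat, map_one, map_natCast] at hr ⊢
    set e0 := expBesselCoeff (l + 1 / 2) ((C x - X) * q) (((C x - X) * q) ^ 2 - q) k
    set e1 := expBesselCoeff (l + 1 / 2) ((C x - X) * q) (((C x - X) * q) ^ 2 - q) (k + 1)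
    set e2 := expBesselCoeff (l + 1 / 2) ((C x - X) * q) (((C x - X) * q) ^ 2 - q) (k + 2)
    set A := C ((ascPochhammer ℂ k).eval (2 * l))
    set F := (k.factorial : ℂ⟦X⟧)
    set G := cpow Q (-l)
    linear_combination (-Q * G * A * F * (2 * C l + k) * (k + 1)) * hr +
      G * A * F * (2 * C l + k) * (k + 1) * (e0 - 2 * (k + 1 + C l) * (C x - X) * e1) * hq

/-! ### Terminating hypergeometric series -/

lemma hypergeometric_neg_nat_hasSum (n : ℕ) (b c u : ℂ) :
    HasSum (fun k : ℕ => (-1) ^ k * (n.choose k : ℂ) * (ascPochhammer ℂ k).eval b *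
      ((ascPochhammer ℂ k).eval c)⁻¹ * u ^ k) (₂F₁ (-(n : ℂ)) b c u) := by
  have hfun : (fun k : ℕ => (-1) ^ k * (n.choose k : ℂ) * (ascPochhammer ℂ k).eval b *
      ((ascPochhammer ℂ k).eval c)⁻¹ * u ^ k) = fun k : ℕ => (((k.factorial : ℂ)⁻¹ *
        (ascPochhammer ℂ k).eval (-(n : ℂ)) * (ascPochhammer ℂ k).eval b *
          ((ascPochhammer ℂ k).eval c)⁻¹) • u ^ k) := by
    funext k
    have h := choose_neg_eq (-(n : ℂ)) k
    rw [neg_neg, Ring.choose_natCast] at h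
    have h2 : (k.factorial : ℂ)⁻¹ * (ascPochhammer ℂ k).eval (-(n : ℂ)) =
        (-1) ^ k * (n.choose k : ℂ) := by
      rw [h, ← mul_assoc, ← mul_pow]; simp
    rw [h2, smul_eq_mul]
  rw [ordinaryHypergeometric_eq_tsum]
  simp only
  rw [← hfun]
  refine (summable_of_ne_finset_zero (s := Finset.range (n + 1)) fun k hk => ?_).hasSum
  rw [Nat.choose_eq_zero_of_lt (by simpa using hk)]
  simp

/-- Chu–Vandermonde: expand `choose (-b + (c+n-1)) n`, where `(a)_m = m! choose (a+m-1) m`. -/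
lemma hypergeometric_neg_nat_one {b c : ℂ} (hc : ∀ k : ℕ, c ≠ -(k : ℂ)) (n : ℕ) :
    ₂F₁ (-(n : ℂ)) b c (1 : ℂ) =
      (ascPochhammer ℂ n).eval (c - b) / (ascPochhammer ℂ n).eval c := by
  refine (hypergeometric_neg_nat_hasSum n b c 1).unique ?_
  have hs : HasSum (fun k : ℕ => (-1) ^ k * (n.choose k : ℂ) * (ascPochhammer ℂ k).eval b *
      ((ascPochhammer ℂ k).eval c)⁻¹ * 1 ^ k)
      (∑ k ∈ Finset.range (n + 1), (-1) ^ k * (n.choose k : ℂ) * (ascPochhammer ℂ k).eval b *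
        ((ascPochhammer ℂ k).eval c)⁻¹ * 1 ^ k) :=
    hasSum_sum_of_ne_finset_zero fun k hk => by
      rw [Nat.choose_eq_zero_of_lt (by simpa using hk)]; simp
  convert hs using 1
  have hcn := ascPochhammer_eval_ne_zero hc n
  have h := Ring.add_choose_eq n (Commute.all (-b) (c + n - 1))
  rw [Finset.Nat.sum_antidiagonal_eq_sum_range_succ_mk] at h
  have hchoose : ∀ (a : ℂ) (m : ℕ), (m.factorial : ℂ) * Ring.choose (a + m - 1) m =
      (ascPochhammer ℂ m).eval a := by
    intro a m
    rw [← Ring.multichoose_eq, ← nsmul_eq_mul,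
      Ring.factorial_nsmul_multichoose_eq_ascPochhammer, Polynomial.ascPochhammer_smeval_eq_eval]
  rw [div_eq_iff hcn, ← hchoose, show c - b + n - 1 = -b + (c + n - 1) by ring, h, Finset.mul_sum,
    Finset.sum_mul]
  refine Finset.sum_congr rfl fun k hk => ?_
  have hkn : k ≤ n := Nat.lt_succ_iff.1 (Finset.mem_range.1 hk)
  obtain ⟨m, rfl⟩ := Nat.exists_eq_add_of_le hkn
  have hck := ascPochhammer_eval_ne_zero hc k
  have h2 := hchoose (c + k) m
  have hk0 : (k.factorial : ℂ) ≠ 0 := by exact_mod_cast k.factorial_ne_zero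
  have hm0 : (m.factorial : ℂ) ≠ 0 := by exact_mod_cast m.factorial_ne_zero
  have h3 : ((k + m).choose k : ℂ) * (k.factorial * m.factorial) = ((k + m).factorial : ℂ) := by
    have := Nat.choose_mul_factorial_mul_factorial hkn
    rw [Nat.add_sub_cancel_left] at this
    rw [← mul_assoc]
    exact_mod_cast this
  rw [ascPochhammer_eval_add, ← h2, choose_neg_eq, ← h3]
  simp only [Nat.add_sub_cancel_left]
  push_cast
  rw [show c + k + m - 1 = c + (k + m) - 1 by ring]
  field_simp
  ring

lemma coeff_X_pow_mul_iterate_derivative (G : ℂ⟦X⟧) (d k : ℕ) :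
    coeff d (X ^ k * (d⁄dX ℂ)^[k] G) = (k.factorial : ℂ) * (d.choose k : ℂ) * coeff d G := by
  rw [coeff_X_pow_mul']
  split_ifs with h
  · obtain ⟨m, rfl⟩ := Nat.exists_eq_add_of_le' h
    rw [Nat.add_sub_cancel, coeff_iterate_derivative, Nat.ascFactorial_eq_factorial_mul_choose]
    push_cast
    rfl
  · rw [Nat.choose_eq_zero_of_lt (by omega)]
    simp

/-- The operator `Xᵏ (d/dX)ᵏ / k!` multiplies the coefficient of `Xⁿ` by `n choose k`, exactly the
binomial in the terminating `₂F₁`. -/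
lemma hasSum_iterate_derivative (w c u : ℂ) (G : ℂ⟦X⟧) :
    HasSum (fun k : ℕ => C ((ascPochhammer ℂ k).eval w) * (-(C u * X)) ^ k *
        (C (((k.factorial : ℂ) * (ascPochhammer ℂ k).eval c)⁻¹) * (d⁄dX ℂ)^[k] G))
      (PowerSeries.mk fun n : ℕ => ₂F₁ (-(n : ℂ)) w c u * coeff n G) := by
  rw [PowerSeries.WithPiTopology.hasSum_iff_hasSum_coeff]
  intro d
  rw [coeff_mk]
  refine hasSum_of_forall_eq ((hypergeometric_neg_nat_hasSum d w c u).mul_right (coeff d G))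
    fun k => ?_
  have e : C ((ascPochhammer ℂ k).eval w) * (-(C u * X)) ^ k *
      (C (((k.factorial : ℂ) * (ascPochhammer ℂ k).eval c)⁻¹) * (d⁄dX ℂ)^[k] G) =
      C ((ascPochhammer ℂ k).eval w * (-u) ^ k * ((k.factorial : ℂ) *
        (ascPochhammer ℂ k).eval c)⁻¹) * (X ^ k * (d⁄dX ℂ)^[k] G) := by
    rw [← neg_mul, mul_pow, map_mul, map_mul, map_pow, map_neg]
    ring
  have hk : (k.factorial : ℂ) * (k.factorial : ℂ)⁻¹ = 1 :=
    mul_inv_cancel₀ (by exact_mod_cast k.factorial_ne_zero)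
  rw [e, coeff_C_mul, coeff_X_pow_mul_iterate_derivative, mul_inv, neg_pow]
  linear_combination ((ascPochhammer ℂ k).eval w * ((-1) ^ k * u ^ k) *
    ((ascPochhammer ℂ k).eval c)⁻¹ * (d.choose k : ℂ) * coeff d G) * hk

lemma generating_function_eq {l : ℂ} (hl : ∀ k : ℕ, l ≠ -((k : ℂ) / 2)) (w x u : ℂ) {q : ℂ⟦X⟧}
    (hq : (1 - 2 * C x * X + X ^ 2) * q = 1) :
    (PowerSeries.mk fun n : ℕ => ₂F₁ (-(n : ℂ)) w (2 * l) u * (gegenbauer l n).eval x) =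
      cpow (1 - 2 * C x * X + X ^ 2) (-l) *
        (cpow (1 - -(C u * X) * ((C x - X) * q)) (-w) *
          hypSubst (w / 2) (w / 2 + 1 / 2) (l + 1 / 2) ((((C x - X) * q) ^ 2 - q) *
            (-(C u * X)) ^ 2 * ((1 - -(C u * X) * ((C x - X) * q))⁻¹) ^ 2)) := by
  have h1 : ∀ k : ℕ, l + 1 / 2 ≠ -(k : ℂ) := by
    intro k h
    -- The excluded odd half-integers keep `l + 1/2` off the non-positive integers.
    apply hl (2 * k + 1)
    push_cast
    linear_combination h
  have h2 : ∀ k : ℕ, 2 * l ≠ -(k : ℂ) := by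
    intro k h
    apply hl k
    linear_combination h / 2
  simp only [gegenbauer_eval]
  refine (hasSum_iterate_derivative w (2 * l) u _).unique ?_
  refine hasSum_of_forall_eq ((hasSum_expBesselCoeff (l + 1 / 2) w ((C x - X) * q)
    (((C x - X) * q) ^ 2 - q) (f := -(C u * X)) (by simp)).mul_left _) fun k => ?_
  rw [iterate_derivative_cpow h1 x hq]
  have h3 : (C (((k.factorial : ℂ) * (ascPochhammer ℂ k).eval (2 * l))⁻¹) : ℂ⟦X⟧) *
      C ((k.factorial : ℂ) * (ascPochhammer ℂ k).eval (2 * l)) = 1 := by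
    rw [← map_mul, inv_mul_cancel₀, map_one]
    exact mul_ne_zero (by exact_mod_cast k.factorial_ne_zero) (ascPochhammer_eval_ne_zero h2 k)
  set e := expBesselCoeff (l + 1 / 2) ((C x - X) * q) (((C x - X) * q) ^ 2 - q) k
  linear_combination C ((ascPochhammer ℂ k).eval w) * (-(C u * X)) ^ k *
    cpow (1 - 2 * C x * X + X ^ 2) (-l) * e * h3

/-! ### The series R, U, V and the closed forms -/

lemma constantCoeff_seriesR (x : ℂ) : constantCoeff (seriesR x) = 1 :=
  constantCoeff_cpow (by simp) _

lemma constantCoeff_seriesU (x u : ℂ) : constantCoeff (seriesU x u) = 1 :=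
  constantCoeff_cpow (by simp) _

lemma constantCoeff_seriesV (x u : ℂ) : constantCoeff (seriesV x u) = 1 := by
  simp [seriesV, constantCoeff_seriesR]

lemma cpow_half_sq {f : ℂ⟦X⟧} (hf : constantCoeff f = 1) : cpow f (1 / 2) ^ 2 = f := by
  rw [sq, ← cpow_add hf, add_halves, cpow_one hf]

lemma seriesR_sq (x : ℂ) : seriesR x ^ 2 = 1 - 2 * C x * X + X ^ 2 :=
  cpow_half_sq (by simp)

lemma seriesU_sq (x u : ℂ) :
    seriesU x u ^ 2 = 1 - 2 * C ((1 - u) * x) * X + C ((1 - u) ^ 2) * X ^ 2 :=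
  cpow_half_sq (by simp)

lemma seriesV_sq_sub (x u : ℂ) :
    seriesV x u ^ 2 - (seriesU x u * seriesR x) ^ 2 = (C x ^ 2 - 1) * (C u * X) ^ 2 := by
  rw [mul_pow, seriesU_sq, seriesV, seriesR_sq]
  simp only [map_mul, map_pow, map_sub, map_one]
  ring

/-- The generating function in terms of `₂F₁(w / 2, w / 2 + 1 / 2; l + 1 / 2; 1 - (U R / V) ^ 2)`
for an arbitrary parameter `w`. -/
lemma generating_function_eq_seriesV {l : ℂ} (hl : ∀ k : ℕ, l ≠ -((k : ℂ) / 2)) (w x u : ℂ) :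
    (PowerSeries.mk fun n : ℕ => ₂F₁ (-(n : ℂ)) w (2 * l) u * (gegenbauer l n).eval x) =
      cpow (seriesR x) (2 * w - 2 * l) * (cpow (seriesV x u) (-w) *
        hypSubst (w / 2) (w / 2 + 1 / 2) (l + 1 / 2)
          (1 - (seriesU x u * seriesR x * (seriesV x u)⁻¹) ^ 2)) := by
  have hR := constantCoeff_seriesR x
  have hV := constantCoeff_seriesV x u
  have hQ := seriesR_sq x
  have hRi : seriesR x * (seriesR x)⁻¹ = 1 := PowerSeries.mul_inv_cancel _ (by simp [hR])
  have hVi : seriesV x u * (seriesV x u)⁻¹ = 1 := PowerSeries.mul_inv_cancel _ (by simp [hV])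
  set R := seriesR x with hRdef
  set V := seriesV x u with hVdef
  have hq : (1 - 2 * C x * X + X ^ 2) * (R⁻¹ ^ 2) = 1 := by
    rw [← hQ, ← mul_pow, hRi, one_pow]
  rw [generating_function_eq hl w x u hq]
  -- Here `1 + ut(x-t)/R² = V/R²`; its power `-w` supplies the exponent `2w` of `R`, and `Q^(-l)`
  -- supplies `-2l`.
  have e1 : 1 - -(C u * X) * ((C x - X) * R⁻¹ ^ 2) = V * R⁻¹ ^ 2 := by
    rw [hVdef, seriesV, ← hRdef]
    linear_combination (-(R * R⁻¹) - 1) * hRi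
  have hRi1 : constantCoeff R⁻¹ = 1 := by simp [hR]
  have e2 : cpow (V * R⁻¹ ^ 2) (-w) = cpow V (-w) * cpow R (2 * w) := by
    rw [mul_cpow hV (by simp [hR]), ← cpow_natCast hRi1, cpow_cpow hRi1, cpow_inv hR]
    congr 2; push_cast; ring
  have e3 : cpow (1 - 2 * C x * X + X ^ 2) (-l) = cpow R (-(2 * l)) := by
    rw [← hQ, ← cpow_natCast hR, cpow_cpow hR]
    congr 1; push_cast; ring
  have e4 : (V * R⁻¹ ^ 2)⁻¹ = V⁻¹ * R ^ 2 := by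
    symm
    rw [PowerSeries.eq_inv_iff_mul_eq_one (by simp [hV, hR])]
    linear_combination (R * R⁻¹) ^ 2 * hVi + (R * R⁻¹ + 1) * hRi
  have e5 : (((C x - X) * R⁻¹ ^ 2) ^ 2 - R⁻¹ ^ 2) * (-(C u * X)) ^ 2 * (V⁻¹ * R ^ 2) ^ 2 =
      1 - (seriesU x u * R * V⁻¹) ^ 2 := by
    have h := seriesV_sq_sub x u
    rw [← hVdef, ← hRdef] at h
    have e6 : 1 - (seriesU x u * R * V⁻¹) ^ 2 = (C x ^ 2 - 1) * (C u * X) ^ 2 * V⁻¹ ^ 2 := by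
      rw [← h]
      linear_combination (-(V * V⁻¹) - 1) * hVi
    have e7 : (R * R⁻¹) ^ 2 = 1 := by rw [hRi, one_pow]
    rw [e6]
    have e8 : (((C x - X) * R⁻¹ ^ 2) ^ 2 - R⁻¹ ^ 2) * R ^ 4 = C x ^ 2 - 1 := by
      have : (C x - X) ^ 2 - R ^ 2 = C x ^ 2 - 1 := by rw [hQ]; ring
      rw [← this]
      linear_combination ((C x - X) ^ 2 * ((R * R⁻¹) ^ 2 + 1) - R ^ 2) * e7
    linear_combination (C u * X) ^ 2 * V⁻¹ ^ 2 * e8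
  rw [e1, e2, e3, e4, e5, show 2 * w - 2 * l = -(2 * l) + 2 * w by ring, cpow_add hR]
  ring

lemma hypSubst_symm (a b c : ℂ) (f : ℂ⟦X⟧) : hypSubst a b c f = hypSubst b a c f := by
  have h : hypSeries a b c = hypSeries b a c := by
    ext n
    simp only [hypSeries, coeff_mk, ordinaryHypergeometricCoefficient]
    ring
  rw [hypSubst, hypSubst, h]

/-- For `y = (UR - V)/(2UR)` one has `1 - 2y = V/(UR)`, so this is the quadratic transformation at
`y`. -/
lemma hypSubst_seriesUR {a b c : ℂ} (hc : ∀ k : ℕ, c ≠ -(k : ℂ)) (habc : a + b + 1 = 2 * c)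
    {U R V : ℂ⟦X⟧} (hU : constantCoeff U = 1) (hR : constantCoeff R = 1)
    (hV : constantCoeff V = 1) :
    hypSubst a b c ((U * R - V) * (2 * U * R)⁻¹) = cpow V (-a) * cpow U a * cpow R a *
      hypSubst (a / 2) (a / 2 + 1 / 2) c (1 - (U * R * V⁻¹) ^ 2) := by
  have hUR : constantCoeff (U * R) = 1 := by simp [hU, hR]
  have hURi : U * R * (U * R)⁻¹ = 1 := PowerSeries.mul_inv_cancel _ (by simp [hUR])
  have hVi : V * V⁻¹ = 1 := PowerSeries.mul_inv_cancel _ (by simp [hV])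
  have h2i : 2 * U * R * (2 * U * R)⁻¹ = 1 :=
    PowerSeries.mul_inv_cancel _ (by rw [mul_assoc, map_mul, hUR, map_ofNat]; simp)
  have hUR0 : U * R ≠ 0 := left_ne_zero_of_mul_eq_one hURi
  have e1 : 1 - 2 * ((U * R - V) * (2 * U * R)⁻¹) = V * (U * R)⁻¹ := by
    apply mul_left_cancel₀ hUR0
    linear_combination (V - U * R) * h2i - V * hURi
  have e2 : (V * (U * R)⁻¹)⁻¹ = U * R * V⁻¹ := by
    symm
    rw [PowerSeries.eq_inv_iff_mul_eq_one (by simp [hV, hU, hR])]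
    linear_combination U * R * (U * R)⁻¹ * hVi + hURi
  rw [hypSubst_eq_quadratic hc habc (by simp [hU, hR, hV]), e1, e2,
    mul_cpow hV (by simp [hU, hR]), cpow_inv hUR, neg_neg, mul_cpow hU hR]
  ring

theorem generating_function_first_form {l : ℂ} (hl : ∀ k : ℕ, l ≠ -((k : ℂ) / 2)) (γ x u : ℂ) :
    (PowerSeries.mk fun n : ℕ => ₂F₁ (-(n : ℂ)) (2 * l - γ) (2 * l) u * (gegenbauer l n).eval x) =
      cpow (seriesU x u) (γ - 2 * l) * cpow (seriesR x) (-γ) *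
        hypSubst γ (2 * l - γ) (l + 1 / 2)
          ((seriesU x u * seriesR x - seriesV x u) * (2 * seriesU x u * seriesR x)⁻¹) := by
  have hU := constantCoeff_seriesU x u
  have hR := constantCoeff_seriesR x
  have hV := constantCoeff_seriesV x u
  have hc : ∀ k : ℕ, l + 1 / 2 ≠ -(k : ℂ) := by
    intro k h
    apply hl (2 * k + 1)
    push_cast
    linear_combination h
  -- The swap puts `2l - γ` first, so the quadratic transformation yields the `₂F₁` with parameter
  -- `w = 2l - γ`.
  rw [generating_function_eq_seriesV hl, hypSubst_symm γ,
    hypSubst_seriesUR hc (by ring) hU hR hV, show γ - 2 * l = -(2 * l - γ) by ring,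
    show 2 * (2 * l - γ) - 2 * l = -γ + (2 * l - γ) by ring, cpow_add hR]
  linear_combination (-(cpow (seriesR x) (-γ) * cpow (seriesR x) (2 * l - γ) *
    (cpow (seriesV x u) (-(2 * l - γ)) * hypSubst ((2 * l - γ) / 2) ((2 * l - γ) / 2 + 1 / 2)
      (l + 1 / 2) (1 - (seriesU x u * seriesR x * (seriesV x u)⁻¹) ^ 2)))) *
        cpow_mul_cpow_neg hU (2 * l - γ)

theorem generating_function_second_form {l : ℂ} (hl : ∀ k : ℕ, l ≠ -((k : ℂ) / 2)) (γ x u : ℂ) :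
    (PowerSeries.mk fun n : ℕ => ₂F₁ (-(n : ℂ)) (2 * l - γ) (2 * l) u * (gegenbauer l n).eval x) =
      cpow (seriesU x u) (2 * γ - 2 * l) * cpow (seriesV x u) (-γ) *
        hypSubst (γ / 2) (γ / 2 + 1 / 2) (l + 1 / 2)
          (1 - (seriesU x u * seriesR x * (seriesV x u)⁻¹) ^ 2) := by
  have hU := constantCoeff_seriesU x u
  have hR := constantCoeff_seriesR x
  have hV := constantCoeff_seriesV x u
  have hc : ∀ k : ℕ, l + 1 / 2 ≠ -(k : ℂ) := by
    intro k h
    apply hl (2 * k + 1)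
    push_cast
    linear_combination h
  -- Unswapped, the same transformation now produces the parameter `γ`, and the powers of `R`
  -- cancel.
  rw [generating_function_first_form hl, hypSubst_seriesUR hc (by ring) hU hR hV,
    show 2 * γ - 2 * l = (γ - 2 * l) + γ by ring, cpow_add hU]
  linear_combination cpow (seriesU x u) (γ - 2 * l) * (cpow (seriesV x u) (-γ) *
    cpow (seriesU x u) γ * hypSubst (γ / 2) (γ / 2 + 1 / 2) (l + 1 / 2)
      (1 - (seriesU x u * seriesR x * (seriesV x u)⁻¹) ^ 2)) * cpow_mul_cpow_neg hR γ

lemma one_cpow (a : ℂ) : cpow (1 : ℂ⟦X⟧) a = 1 :=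
  (eq_cpow_of_derivative (by simp) (by simp) (by simp)).symm

lemma seriesU_one (x : ℂ) : seriesU x 1 = 1 := by
  rw [seriesU]
  simp [one_cpow]

lemma seriesV_one (x : ℂ) : seriesV x 1 = 1 - C x * X := by
  rw [seriesV, seriesR_sq, map_one]
  ring

end Gegenbauer

end

theorem mainTheorem7 (l γ x : ℂ) (hl : ∀ k : ℕ, l ≠ -((k : ℂ) / 2)) :
    (∀ u : ℂ,
      PowerSeries.mk (fun n : ℕ =>
          ₂F₁ (-(n : ℂ)) (2 * l - γ) (2 * l) u * (Gegenbauer.gegenbauer l n).eval x) =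
        Gegenbauer.cpow (Gegenbauer.seriesU x u) (γ - 2 * l) *
          Gegenbauer.cpow (Gegenbauer.seriesR x) (-γ) *
          Gegenbauer.hypSubst γ (2 * l - γ) (l + 1 / 2)
            ((Gegenbauer.seriesU x u * Gegenbauer.seriesR x - Gegenbauer.seriesV x u) *
              (2 * Gegenbauer.seriesU x u * Gegenbauer.seriesR x)⁻¹) ∧
      PowerSeries.mk (fun n : ℕ =>
          ₂F₁ (-(n : ℂ)) (2 * l - γ) (2 * l) u * (Gegenbauer.gegenbauer l n).eval x) =
        Gegenbauer.cpow (Gegenbauer.seriesU x u) (2 * γ - 2 * l) *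
          Gegenbauer.cpow (Gegenbauer.seriesV x u) (-γ) *
          Gegenbauer.hypSubst (γ / 2) (γ / 2 + 1 / 2) (l + 1 / 2)
            (1 - (Gegenbauer.seriesU x u * Gegenbauer.seriesR x *
              (Gegenbauer.seriesV x u)⁻¹) ^ 2)) ∧
    -- The case `u = 1`: the left-hand coefficients simplify, and both forms reduce.
    (∀ n : ℕ, ₂F₁ (-(n : ℂ)) (2 * l - γ) (2 * l) (1 : ℂ) =
      (ascPochhammer ℂ n).eval γ / (ascPochhammer ℂ n).eval (2 * l)) ∧
    Gegenbauer.seriesU x 1 = 1 ∧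
    Gegenbauer.seriesV x 1 = 1 - PowerSeries.C x * PowerSeries.X ∧
    PowerSeries.mk (fun n : ℕ =>
        (ascPochhammer ℂ n).eval γ / (ascPochhammer ℂ n).eval (2 * l) *
          (Gegenbauer.gegenbauer l n).eval x) =
      Gegenbauer.cpow (Gegenbauer.seriesR x) (-γ) *
        Gegenbauer.hypSubst γ (2 * l - γ) (l + 1 / 2)
          ((Gegenbauer.seriesR x - 1 + PowerSeries.C x * PowerSeries.X) *
            (2 * Gegenbauer.seriesR x)⁻¹) ∧
    PowerSeries.mk (fun n : ℕ =>
        (ascPochhammer ℂ n).eval γ / (ascPochhammer ℂ n).eval (2 * l) *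
          (Gegenbauer.gegenbauer l n).eval x) =
      Gegenbauer.cpow (1 - PowerSeries.C x * PowerSeries.X) (-γ) *
        Gegenbauer.hypSubst (γ / 2) (γ / 2 + 1 / 2) (l + 1 / 2)
          (1 - (Gegenbauer.seriesR x *
            (1 - PowerSeries.C x * PowerSeries.X)⁻¹) ^ 2) := by
  have h2 : ∀ k : ℕ, 2 * l ≠ -(k : ℂ) := by
    intro k h
    apply hl k
    linear_combination h / 2
  have h1 : ∀ n : ℕ, ₂F₁ (-(n : ℂ)) (2 * l - γ) (2 * l) (1 : ℂ) =
      (ascPochhammer ℂ n).eval γ / (ascPochhammer ℂ n).eval (2 * l) := by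
    intro n
    rw [Gegenbauer.hypergeometric_neg_nat_one h2, sub_sub_cancel]
  refine ⟨fun u => ⟨Gegenbauer.generating_function_first_form hl γ x u,
    Gegenbauer.generating_function_second_form hl γ x u⟩, h1, Gegenbauer.seriesU_one x, Gegenbauer.seriesV_one x, ?_, ?_⟩
  · have h := Gegenbauer.generating_function_first_form hl γ x 1
    simp only [h1, Gegenbauer.seriesU_one, Gegenbauer.seriesV_one, Gegenbauer.one_cpow, one_mul, mul_one] at h
    rw [h, sub_add]
  · have h := Gegenbauer.generating_function_second_form hl γ x 1
    simpa only [h1, Gegenbauer.seriesU_one, Gegenbauer.seriesV_one, Gegenbauer.one_cpow, one_mul] using h
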